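/- Let $n\ge 0$ and $m\ge 1$ be integers. An $m$-shelf shuffle of $n$ cards labelled $1,\dots,n$ is the following random permutation: each card is placed, independently and uniformly at random, into one of $2m$ piles labelled $1,\dots,2m$; the cards in each odd-labelled pile are put in increasing order, those in each even-labelled pile in decreasing order; and the deck is formed by placing pile $1$ at the top, followed by pile $2$, and so on up to pile $2m$. Write $\pi(i)$ for the card in position $i$ from the top of the resulting deck, and let $$d_{n,m}=\#\{1\le i\le n-1:\ \pi(i)>\pi(i+1)\}$$ be its number of descents. **Theorem (CLT for descents).** Let $(m_n)_{n\ge 0}$ be a sequence of positive integers with $m_n=o(\sqrt n)$ as $n\to\infty$. Then $$\frac{d_{n,m_n}-\frac n2}{\sqrt{n/4}}\ \Rightarrow_d\ \mathcal N(0,1),$$ that is, for every $x\in\mathbb R$, $$\lim_{n\to\infty}P\left(\frac{d_{n,m_n}-\frac n2}{\sqrt{n/4}}\le x\right)=\frac1{\sqrt{2\pi}}\int_{-\infty}^x e^{-s^2/2}\,ds .$$ In particular, the convergence holds when $m_n=m$ is a fixed positive integer. -/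

import Mathlib

open Filter Topology MeasureTheory ProbabilityTheory Asymptotics

/-- Permutations of finitely many cards carry the discrete σ-algebra. -/
instance instMeasurableSpacePermFin (n : ℕ) : MeasurableSpace (Equiv.Perm (Fin n)) := ⊤

/-- The law of a random word `(X_1, …, X_n)` whose letters are iid uniform on the `2m` piles.
Pile number `k` of `{1, …, 2m}` is the element `k - 1` of `Fin (2 * m)`; likewise for cards. -/
noncomputable def randomWord (n m : ℕ) : Measure (Fin n → Fin (2 * m)) :=
  Measure.pi fun _ => uniformOn (Set.univ : Set (Fin (2 * m)))

/-- The key by which the cards are sorted: first the pile, then the position inside the pile.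
Odd-numbered piles (even index in `Fin (2 * m)`) keep the order of their cards,
even-numbered piles (odd index) reverse it. -/
def shelfKey {n m : ℕ} (w : Fin n → Fin (2 * m)) (c : Fin n) : Fin (2 * m) ×ₗ Fin n :=
  toLex (w c, if Even (w c).val then c else Fin.rev c)

/-- The deck obtained when card `c` is put into pile `w c`: `shelfPerm w i` is the card
in position `i`, counted from the top. -/
def shelfPerm {n m : ℕ} (w : Fin n → Fin (2 * m)) : Equiv.Perm (Fin n) :=
  Tuple.sort (shelfKey w)

/-- The probability measure on permutations induced by an `m`-shelf shuffle of `n` cards. -/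
noncomputable def shelfShuffle (n m : ℕ) : Measure (Equiv.Perm (Fin n)) :=
  (randomWord n m).map shelfPerm

/-- The number of descents: positions `i` with `π(i) > π(i+1)`. -/
def descents {n : ℕ} (π : Equiv.Perm (Fin n)) : ℕ :=
  (Finset.univ.filter fun i : Fin n =>
    ∃ h : i.val + 1 < n, π ⟨i.val + 1, h⟩ < π i).card

/-- The random variables `X n`, on probability spaces `(Ω n, P n)`, converge in distribution to a
normal random variable with mean `μ` and variance `v > 0`. -/
def ConvergesToNormal {Ω : ℕ → Type*} [∀ n, MeasurableSpace (Ω n)]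
    (P : ∀ n, Measure (Ω n)) (X : ∀ n, Ω n → ℝ) (μ v : ℝ) : Prop :=
  ∀ x : ℝ, Tendsto (fun n => (P n).real {ω | X n ω ≤ x}) atTop
    (𝓝 ((√(2 * Real.pi * v))⁻¹ * ∫ s in Set.Iic x, Real.exp (-(s - μ) ^ 2 / (2 * v))))

/-- The number of descents, centred at `n/2` and scaled by `√(n/4)`. -/
noncomputable def normalizedDescents (n : ℕ) (π : Equiv.Perm (Fin n)) : ℝ :=
  ((descents π : ℝ) - (n : ℝ) / 2) / √((n : ℝ) / 4)

/-!
The increasing piles of the shuffled deck contain no descent, and a decreasing pile of `s ≥ 1`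
cards contains `s - 1` of them; the only other possible descents lie at the junctions of
consecutive piles. Hence a position that is not the last of its pile is a descent exactly when its
card lies in a decreasing pile, and since there are at most `2m` piles, the number of descents
differs by at most `2m` from the number `B` of cards in decreasing piles
(`abs_descents_sub_numDecreasing_le`).

The piles of the `n` cards are independent, and each is decreasing with probability `1/2`, so
`(B - n/2) / √(n/4)` is `n^(-1/2)` times a sum of `n` independent fair signs. Its characteristic
function is `cos (t / √n) ^ n` whatever the value of `m` (`charFun_map_sum_pileSign`), and tends to
`exp (-t²/2)` (`tendsto_cos_inv_sqrt_mul_pow`).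

After normalization the two variables differ by at most `4m / √n`, which tends to `0` when
`m = o(√n)`; therefore their characteristic functions have the same limit
(`norm_charFun_map_sub_le`). Lévy's continuity theorem and the portmanteau theorem turn this into
convergence of the distribution functions (`convergesToNormal_of_tendsto_charFun`).
-/

/-! ### Descents and decreasing piles -/

/-- The sign of a pile: `1` if its cards are put in decreasing order, `-1` if they are put in
increasing order. Under the uniform law on the piles it is a fair random sign. -/
noncomputable def pileSign {m : ℕ} (k : Fin (2 * m)) : ℝ := if Even k.val then -1 else 1

/-- The number of cards that go into decreasing piles. -/
def numDecreasing {n m : ℕ} (w : Fin n → Fin (2 * m)) : ℕ :=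
  (Finset.univ.filter fun c : Fin n => ¬ Even (w c).val).card

lemma monotone_pile_shelfPerm {n m : ℕ} (w : Fin n → Fin (2 * m)) :
    Monotone fun i => w (shelfPerm w i) := fun _ _ h =>
  Prod.Lex.monotone_fst _ _ (Tuple.monotone_sort (shelfKey w) h)

/-- Two adjacent cards of the deck that come from the same pile form a descent exactly when
that pile is decreasing. -/
lemma shelfPerm_descent_iff {n m : ℕ} (w : Fin n → Fin (2 * m)) {i j : Fin n} (hij : i < j)
    (hw : w (shelfPerm w i) = w (shelfPerm w j)) :
    shelfPerm w j < shelfPerm w i ↔ ¬ Even (w (shelfPerm w i)).val := by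
  have hne : shelfPerm w i ≠ shelfPerm w j := (shelfPerm w).injective.ne hij.ne
  have h : shelfKey w (shelfPerm w i) ≤ shelfKey w (shelfPerm w j) :=
    Tuple.monotone_sort (shelfKey w) hij.le
  simp only [shelfKey, Prod.Lex.toLex_le_toLex, ← hw, lt_irrefl, true_and, false_or] at h
  split_ifs at h with he
  · simp [he, h]
  · simpa [he] using lt_of_le_of_ne (Fin.rev_le_rev.1 h) hne.symm

/-- Positions that are the last of their pile in the deck. -/
def pileEnds {n m : ℕ} (w : Fin n → Fin (2 * m)) : Finset (Fin n) :=
  Finset.univ.filter fun i => ∀ j, i < j → w (shelfPerm w i) < w (shelfPerm w j)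

lemma card_pileEnds_le {n m : ℕ} (w : Fin n → Fin (2 * m)) : (pileEnds w).card ≤ 2 * m := by
  have : Set.InjOn (fun i => w (shelfPerm w i)) (pileEnds w) := by
    intro i hi j hj hij
    simp only [pileEnds, Finset.coe_filter, Finset.mem_univ, true_and, Set.mem_ofPred_eq] at hi hj
    rcases lt_trichotomy i j with h | h | h
    · exact absurd hij (hi j h).ne
    · exact h
    · exact absurd hij (hj i h).ne'
  simpa using Finset.card_le_card_of_injOn (t := Finset.univ) _ (fun _ _ => Finset.mem_univ _) this

lemma numDecreasing_eq_card_positions {n m : ℕ} (w : Fin n → Fin (2 * m)) :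
    numDecreasing w =
      (Finset.univ.filter fun i : Fin n => ¬ Even (w (shelfPerm w i)).val).card := by
  symm
  refine Finset.card_equiv (shelfPerm w) fun i => ?_
  simp

/-- Away from the ends of the piles, a position is a descent exactly when it lies in a decreasing
pile. -/
lemma descent_iff_of_notMem_pileEnds {n m : ℕ} (w : Fin n → Fin (2 * m)) {i : Fin n}
    (hi : i ∉ pileEnds w) :
    (∃ h : i.val + 1 < n, shelfPerm w ⟨i.val + 1, h⟩ < shelfPerm w i) ↔
      ¬ Even (w (shelfPerm w i)).val := by
  simp only [pileEnds, Finset.mem_filter, Finset.mem_univ, true_and, not_forall, not_lt] at hi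
  obtain ⟨j, hij, hj⟩ := hi
  have h : i.val + 1 < n := lt_of_le_of_lt (Nat.succ_le_of_lt hij) j.isLt
  have hlt : i < ⟨i.val + 1, h⟩ := Nat.lt_succ_self i.val
  have hle : (⟨i.val + 1, h⟩ : Fin n) ≤ j := Nat.succ_le_of_lt hij
  have hw := le_antisymm (monotone_pile_shelfPerm w hlt.le)
    ((monotone_pile_shelfPerm w hle).trans hj)
  rw [← shelfPerm_descent_iff w hlt hw]
  exact ⟨fun ⟨_, h'⟩ => h', fun h' => ⟨h, h'⟩⟩

lemma abs_descents_sub_numDecreasing_le {n m : ℕ} (w : Fin n → Fin (2 * m)) :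
    |(descents (shelfPerm w) : ℝ) - numDecreasing w| ≤ 2 * m := by
  have h1 : descents (shelfPerm w) ≤ numDecreasing w + 2 * m := by
    rw [numDecreasing_eq_card_positions, descents]
    refine (Finset.card_le_card (t := _ ∪ pileEnds w) fun i hi => ?_).trans
      ((Finset.card_union_le _ _).trans (Nat.add_le_add_left (card_pileEnds_le w) _))
    by_cases he : i ∈ pileEnds w
    · exact Finset.mem_union_right _ he
    · refine Finset.mem_union_left _ ?_
      simpa [descent_iff_of_notMem_pileEnds w he] using hi
  have h2 : numDecreasing w ≤ descents (shelfPerm w) + 2 * m := by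
    rw [numDecreasing_eq_card_positions, descents]
    refine (Finset.card_le_card (t := _ ∪ pileEnds w) fun i hi => ?_).trans
      ((Finset.card_union_le _ _).trans (Nat.add_le_add_left (card_pileEnds_le w) _))
    by_cases he : i ∈ pileEnds w
    · exact Finset.mem_union_right _ he
    · refine Finset.mem_union_left _ ?_
      simpa [descent_iff_of_notMem_pileEnds w he] using hi
  have h1' : (descents (shelfPerm w) : ℝ) ≤ numDecreasing w + 2 * m := by exact_mod_cast h1
  have h2' : (numDecreasing w : ℝ) ≤ descents (shelfPerm w) + 2 * m := by exact_mod_cast h2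
  rw [abs_sub_le_iff]
  constructor <;> linarith

lemma sum_pileSign {n m : ℕ} (w : Fin n → Fin (2 * m)) :
    ∑ c, pileSign (w c) = 2 * numDecreasing w - n := by
  have h (k : Fin (2 * m)) : pileSign k = 2 * (if ¬ Even k.val then 1 else 0) - 1 := by
    unfold pileSign
    split_ifs <;> norm_num
  simp_rw [h, Finset.sum_sub_distrib, ← Finset.mul_sum, numDecreasing, Finset.sum_boole]
  simp

/-- The normalized number of descents is, up to `4m / √n`, a normalized sum of independent
signs. -/
lemma abs_normalizedDescents_sub_le {n m : ℕ} (w : Fin n → Fin (2 * m)) :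
    |normalizedDescents n (shelfPerm w) - (√(n : ℝ))⁻¹ * ∑ c, pileSign (w c)| ≤
      4 * (m / √(n : ℝ)) := by
  have hs : √((n : ℝ) / 4) = √(n : ℝ) / 2 := by
    rw [Real.sqrt_div' _ (by norm_num), show (4 : ℝ) = 2 ^ 2 by norm_num,
      Real.sqrt_sq (by norm_num)]
  have h : normalizedDescents n (shelfPerm w) - (√(n : ℝ))⁻¹ * ∑ c, pileSign (w c) =
      2 * (√(n : ℝ))⁻¹ * (descents (shelfPerm w) - numDecreasing w) := by
    rw [normalizedDescents, hs, sum_pileSign, div_div_eq_mul_div, div_eq_mul_inv]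
    ring
  rw [h, abs_mul, abs_of_nonneg (by positivity)]
  calc 2 * (√(n : ℝ))⁻¹ * |(descents (shelfPerm w) : ℝ) - numDecreasing w|
      ≤ 2 * (√(n : ℝ))⁻¹ * (2 * m) := by
        gcongr
        exact abs_descents_sub_numDecreasing_le w
    _ = 4 * (m / √(n : ℝ)) := by ring

/-! ### Characteristic functions of sums of pile signs -/

lemma sum_comp_pileSign (m : ℕ) (f : ℝ → ℂ) :
    ∑ k : Fin (2 * m), f (pileSign k) = m * (f (-1) + f 1) := by
  unfold pileSign
  rw [Fin.sum_univ_eq_sum_range (fun k => f (if Even k then -1 else 1))]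
  induction m with
  | zero => simp
  | succ m ih =>
    rw [show 2 * (m + 1) = 2 * m + 1 + 1 by ring, Finset.sum_range_succ, Finset.sum_range_succ,
      ih, if_pos (even_two_mul m), if_neg (by simp)]
    push_cast
    ring

lemma charFun_map_pileSign {m : ℕ} (hm : 0 < m) (t : ℝ) :
    charFun ((uniformOn (Set.univ : Set (Fin (2 * m)))).map pileSign) t = Complex.cos t := by
  have : NeZero (2 * m) := ⟨by positivity⟩
  rw [charFun_apply_real, integral_map (measurable_of_finite _).aemeasurable (by fun_prop),
    integral_fintype (.of_finite)]
  have hreal (k : Fin (2 * m)) :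
      (uniformOn (Set.univ : Set (Fin (2 * m)))).real {k} = (2 * m : ℝ)⁻¹ := by
    simp [measureReal_def, uniformOn_univ]
  simp_rw [hreal, ← Finset.smul_sum]
  rw [sum_comp_pileSign m fun x => Complex.exp (t * x * Complex.I), Complex.cos,
    Complex.real_smul]
  have : (m : ℂ) ≠ 0 := by exact_mod_cast hm.ne'
  push_cast
  field_simp
  ring_nf

lemma isProbabilityMeasure_randomWord (n : ℕ) {m : ℕ} (hm : 0 < m) :
    IsProbabilityMeasure (randomWord n m) := by
  have : NeZero (2 * m) := ⟨by positivity⟩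
  unfold randomWord
  infer_instance

lemma charFun_map_sum_pileSign (n : ℕ) {m : ℕ} (hm : 0 < m) (a t : ℝ) :
    charFun ((randomWord n m).map fun w => a * ∑ c, pileSign (w c)) t =
      Complex.cos ((a * t : ℝ) : ℂ) ^ n := by
  have : NeZero (2 * m) := ⟨by positivity⟩
  have hmeas : Measurable (pileSign (m := m)) := measurable_of_finite _
  have hindep : iIndepFun (fun (c : Fin n) (w : Fin n → Fin (2 * m)) => pileSign (w c))
      (randomWord n m) :=
    iIndepFun_pi fun _ => hmeas.aemeasurable
  have hlaw (c : Fin n) : (randomWord n m).map (fun w => pileSign (w c)) =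
      (uniformOn (Set.univ : Set (Fin (2 * m)))).map pileSign := by
    rw [← (measurePreserving_eval (fun _ : Fin n => uniformOn (Set.univ : Set (Fin (2 * m)))) c
      ).map_eq, Measure.map_map hmeas (measurable_pi_apply c)]
    rfl
  rw [charFun_map_mul_comp (measurable_of_finite _).aemeasurable,
    hindep.charFun_map_fun_sum_eq_prod fun c => (measurable_of_finite _).aemeasurable]
  simp [hlaw, charFun_map_pileSign hm]

/-- The characteristic function of a fair sign satisfies the limit relation behind the central
limit theorem. -/
lemma tendsto_cos_inv_sqrt_mul_pow (t : ℝ) :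
    Tendsto (fun n : ℕ => Complex.cos (((√(n : ℝ))⁻¹ * t : ℝ) : ℂ) ^ n) atTop
      (𝓝 (Complex.exp (-t ^ 2 / 2))) := by
  have hreal (k : Fin (2 * 1)) :
      (uniformOn (Set.univ : Set (Fin (2 * 1)))).real {k} = 2⁻¹ := by
    simp [measureReal_def, uniformOn_univ]
  have hsq (k : Fin (2 * 1)) : pileSign k ^ 2 = 1 := by
    unfold pileSign
    split_ifs <;> norm_num
  have h := tendsto_charFun_inv_sqrt_mul_pow (P := uniformOn (Set.univ : Set (Fin (2 * 1))))
    (X := pileSign) (measurable_of_finite _).aemeasurable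
    (by rw [integral_fintype .of_finite]; simp [pileSign, Fin.sum_univ_two, measureReal_def,
      uniformOn_univ])
    (by rw [integral_fintype .of_finite]; simp [hsq, hreal]) t
  simpa only [charFun_map_pileSign one_pos] using h

/-! ### Convergence in distribution -/

/-- Two random variables on the same space that are uniformly close have close characteristic
functions, since `x ↦ exp (i t x)` is `|t|`-Lipschitz. -/
lemma norm_charFun_map_sub_le {Ω : Type*} [MeasurableSpace Ω] {P : Measure Ω}
    [IsProbabilityMeasure P] {X Y : Ω → ℝ} (hX : Measurable X) (hY : Measurable Y) {δ : ℝ}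
    (h : ∀ ω, |X ω - Y ω| ≤ δ) (t : ℝ) :
    ‖charFun (P.map X) t - charFun (P.map Y) t‖ ≤ |t| * δ := by
  have hint {Z : Ω → ℝ} (hZ : Measurable Z) :
      Integrable (fun ω => Complex.exp (t * Z ω * Complex.I)) P := by
    refine .of_bound (by fun_prop) 1 (.of_forall fun ω => ?_)
    rw [← Complex.ofReal_mul, Complex.norm_exp_ofReal_mul_I]
  rw [charFun_apply_real, charFun_apply_real, integral_map hX.aemeasurable (by fun_prop),
    integral_map hY.aemeasurable (by fun_prop), ← integral_sub (hint hX) (hint hY)]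
  refine (norm_integral_le_of_norm_le_const (C := |t| * δ) (.of_forall fun ω => ?_)).trans
    (by simp)
  have hfac : Complex.exp (t * X ω * Complex.I) - Complex.exp (t * Y ω * Complex.I) =
      Complex.exp ((t * Y ω : ℝ) * Complex.I) *
        (Complex.exp (Complex.I * (t * (X ω - Y ω) : ℝ)) - 1) := by
    rw [mul_sub, ← Complex.exp_add]
    push_cast
    ring_nf
  rw [hfac, norm_mul, Complex.norm_exp_ofReal_mul_I, one_mul]
  refine (Real.norm_exp_I_mul_ofReal_sub_one_le).trans ?_
  rw [Real.norm_eq_abs, abs_mul]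
  gcongr
  exact h ω

/-- Pointwise convergence of characteristic functions to that of the standard normal law gives
convergence of the distribution functions. -/
lemma convergesToNormal_of_tendsto_charFun {Ω : ℕ → Type*} [∀ n, MeasurableSpace (Ω n)]
    {P : ∀ n, Measure (Ω n)} [∀ n, IsProbabilityMeasure (P n)] {X : ∀ n, Ω n → ℝ}
    (hX : ∀ n, Measurable (X n))
    (h : ∀ t : ℝ, Tendsto (fun n => charFun ((P n).map (X n)) t) atTop
      (𝓝 (Complex.exp (-t ^ 2 / 2)))) :
    ConvergesToNormal P X 0 1 := by
  intro x
  have hprob (n : ℕ) : IsProbabilityMeasure ((P n).map (X n)) :=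
    Measure.isProbabilityMeasure_map (hX n).aemeasurable
  let ν : ℕ → ProbabilityMeasure ℝ := fun n => ⟨(P n).map (X n), hprob n⟩
  let γ : ProbabilityMeasure ℝ := ⟨gaussianReal 0 1, inferInstance⟩
  have hlim : Tendsto ν atTop (𝓝 γ) := by
    refine ProbabilityMeasure.tendsto_of_tendsto_charFun fun t => ?_
    simpa [ν, γ, charFun_gaussianReal, neg_div] using h t
  have hnull : (γ : Measure ℝ) (frontier (Set.Iic x)) = 0 := by
    have := nullSingletonClass_gaussianReal (μ := 0) (v := 1) one_ne_zero
    simp [γ]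
  have hIic := (ENNReal.tendsto_toReal (measure_ne_top _ _)).comp
    (ProbabilityMeasure.tendsto_measure_of_null_frontier_of_tendsto' hlim hnull)
  have hcdf : ((γ : Measure ℝ) (Set.Iic x)).toReal =
      (√(2 * Real.pi * 1))⁻¹ * ∫ s in Set.Iic x, Real.exp (-(s - 0) ^ 2 / (2 * 1)) := by
    change (gaussianReal 0 1 (Set.Iic x)).toReal = _
    rw [gaussianReal_apply_eq_integral _ one_ne_zero, ENNReal.toReal_ofReal
      (integral_nonneg fun s => gaussianPDFReal_nonneg _ _ s), ← integral_const_mul]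
    simp [gaussianPDFReal]
  rw [← hcdf]
  refine hIic.congr fun n => ?_
  change ((P n).map (X n) (Set.Iic x)).toReal = _
  rw [Measure.map_apply (hX n) measurableSet_Iic]
  rfl

lemma convergesToNormal_normalizedDescents {m : ℕ → ℕ} (hm : ∀ n, 0 < m n)
    (ho : (fun n : ℕ => (m n : ℝ)) =o[atTop] (fun n : ℕ => √(n : ℝ))) :
    ConvergesToNormal (fun n => shelfShuffle n (m n)) normalizedDescents 0 1 := by
  have hword (n : ℕ) := isProbabilityMeasure_randomWord n (hm n)
  have hperm (n : ℕ) : Measurable (shelfPerm (n := n) (m := m n)) := measurable_of_finite _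
  have hdesc (n : ℕ) : Measurable (normalizedDescents n) := measurable_of_finite _
  have hshuffle (n : ℕ) : IsProbabilityMeasure (shelfShuffle n (m n)) :=
    Measure.isProbabilityMeasure_map (hperm n).aemeasurable
  refine convergesToNormal_of_tendsto_charFun hdesc fun t => ?_
  have hmap (n : ℕ) : (shelfShuffle n (m n)).map (normalizedDescents n) =
      (randomWord n (m n)).map fun w => normalizedDescents n (shelfPerm w) :=
    Measure.map_map (hdesc n) (hperm n)
  have hδ : Tendsto (fun n : ℕ => |t| * (4 * (m n / √(n : ℝ)))) atTop (𝓝 0) := by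
    simpa using (ho.tendsto_div_nhds_zero.const_mul 4).const_mul |t|
  have hdiff := squeeze_zero_norm (fun n => norm_charFun_map_sub_le (P := randomWord n (m n))
    ((hdesc n).comp (hperm n)) (measurable_of_finite _) abs_normalizedDescents_sub_le t) hδ
  have hsum := hdiff.add (tendsto_cos_inv_sqrt_mul_pow t)
  rw [zero_add] at hsum
  refine hsum.congr fun n => ?_
  rw [charFun_map_sum_pileSign n (hm n), hmap, sub_add_cancel]
  rfl

theorem mainTheorem3 :
    (∀ m : ℕ → ℕ, (∀ n, 0 < m n) →
      (fun n : ℕ => (m n : ℝ)) =o[atTop] (fun n : ℕ => √(n : ℝ)) →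
      ConvergesToNormal (fun n => shelfShuffle n (m n)) normalizedDescents 0 1) ∧
    (∀ m : ℕ, 0 < m →
      ConvergesToNormal (fun n => shelfShuffle n m) normalizedDescents 0 1) := by
  refine ⟨fun m hm ho => convergesToNormal_normalizedDescents hm ho, fun m hm =>
    convergesToNormal_normalizedDescents (m := fun _ => m) (fun _ => hm) ?_⟩
  rw [isLittleO_const_left]
  refine .inr (tendsto_norm_atTop_atTop.comp ?_)
  exact Real.tendsto_sqrt_atTop.comp tendsto_natCast_atTop_atTop
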